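/- Let $M=\widetilde L^{-1}(0)/N$ be the $4$-dimensional toric symplectic manifold obtained by Delzant's construction from the octagon with vertices $(0,2),(0,1),(1,0),(2,0),(3,1),(3,2),(2,3),(1,3)$: here $\widetilde L^{-1}(0)\subset\mathbb C^8$ is the set of $z=(z_1,\dots,z_8)$ with $$|z_1|^2+|z_5|^2=6,\quad |z_2|^2+|z_5|^2+|z_7|^2=10,\quad |z_3|^2+|z_7|^2=6,$$ $$|z_4|^2-|z_5|^2+|z_7|^2=4,\quad |z_5|^2-|z_6|^2+|z_7|^2=2,\quad |z_5|^2-|z_7|^2+|z_8|^2=4,$$ and $N\simeq\mathbb T^6$ is the kernel of the homomorphism of tori $\mathbb T^8\to\mathbb T^2$ induced by the linear map sending $e_1,\dots,e_8$ to $(-1,0),(-1,-1),(0,-1),(1,-1),(1,0),(1,1),(0,1),(-1,1)$, acting on $\mathbb C^8$ by coordinatewise rotation. The symplectic form $\omega$ on $M$ is the one whose pull-back to $\widetilde L^{-1}(0)$ is the restriction of $\omega_{st}=-\frac i2\sum_k dz_k\wedge d\bar z_k$. Let $$J([z])=\tfrac12|z_1|^2,\qquad H([z])=\tfrac12|z_3|^2,\qquad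 X([z])=\Re\bigl(\overline{z_2}\,\overline{z_3}\,\overline{z_4}\,z_6z_7z_8\bigr),$$ let $\gamma\in\mathbb R$ with $\gamma\neq0$, and let $F_t=(J,H_t)$ with $H_t=(1-2t)H+t\gamma X$. For a point $p$ of rank one of $F_t$ (the differential $dF_t(p)$ has rank one), let $L_p\subset T_pM$ be the line spanned by the Hamiltonian vectors of $J$ and $H_t$ at $p$, where the Hamiltonian vector field $\mathcal X^f$ is defined by $\omega(\mathcal X^f,\cdot)=df$; let $L_p^\perp$ be its $\omega$-orthogonal complement, and let $(\mu,\lambda)\neq(0,0)$ be real numbers (unique up to a common factor) with $\mu\,dJ(p)+\lambda\,dH_t(p)=0$. The point $p$ is *nondegenerate* if $\mu\,d^2J(p)+\lambda\,d^2H_t(p)$ descends to an invertible form on $L_p^\perp/L_p$; a nondegenerate $p$ is *of elliptic-regular type* if the eigenvalues of the endomorphism of $L_p^\perp/L_p$ induced by $\omega_p^{-1}(\mu\,d^2J(p)+\lambda\,d^2H_t(p))$ are $\pm ir$ for some real $r\neq0$. **Proposition.** For every $t\in(0,1]$, every rank-one point of $F_t$ in $J^{-1}(0)\cup J^{-1}(3)$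 is nondegenerate and of elliptic-regular type. -/

import Mathlib

open scoped Manifold

/-! ## Linear algebra of rank-one points

`V` is the tangent space, `ω` the symplectic form, `α`, `β` the differentials of the two
integrals, and `L` the line spanned by their Hamiltonian vectors. -/

/-- The span of the Hamiltonian vectors of the covectors `α` and `β`, where the Hamiltonian vector
`v` of `α` is determined by `ω (v, ·) = α`. -/
def hamiltonianSpan {V : Type*} [AddCommGroup V] [Module ℝ V] (ω : LinearMap.BilinForm ℝ V)
    (α β : V →ₗ[ℝ] ℝ) : Submodule ℝ V :=
  Submodule.span ℝ {v | ω v = α ∨ ω v = β}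

/-- The quotient `L^⊥ / L`, with `L^⊥` the orthogonal complement of `L` with respect to `ω`. -/
abbrev OrthoQuotient {V : Type*} [AddCommGroup V] [Module ℝ V] (ω : LinearMap.BilinForm ℝ V)
    (L : Submodule ℝ V) : Type _ :=
  ω.orthogonal L ⧸ L.submoduleOf (ω.orthogonal L)

/-- `B` is the bilinear form on `L^⊥ / L` to which the bilinear form `Q` on `V` descends. -/
def FormDescendsTo {V : Type*} [AddCommGroup V] [Module ℝ V] (ω : LinearMap.BilinForm ℝ V)
    (L : Submodule ℝ V) (Q : LinearMap.BilinForm ℝ V)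
    (B : LinearMap.BilinForm ℝ (OrthoQuotient ω L)) : Prop :=
  ∀ u v : ω.orthogonal L, B (Submodule.Quotient.mk u) (Submodule.Quotient.mk v) = Q u v

/-- `A` maps `L^⊥` to itself and `T` is the endomorphism of `L^⊥ / L` to which `A` descends. -/
def EndDescendsTo {V : Type*} [AddCommGroup V] [Module ℝ V] (ω : LinearMap.BilinForm ℝ V)
    (L : Submodule ℝ V) (A : Module.End ℝ V) (T : Module.End ℝ (OrthoQuotient ω L)) : Prop :=
  ∀ v : ω.orthogonal L, ∃ h : A v ∈ ω.orthogonal L,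
    T (Submodule.Quotient.mk v) = Submodule.Quotient.mk ⟨A v, h⟩

/-- `A = ω⁻¹ Q`: in matrices, `ω (u, v) = uᵀ Ω v`, `Q (u, v) = uᵀ S v` and `A = Ω⁻¹ S`. -/
def IsInverseFormComp {V : Type*} [AddCommGroup V] [Module ℝ V] (ω Q : LinearMap.BilinForm ℝ V)
    (A : Module.End ℝ V) : Prop :=
  ∀ u v : V, ω u (A v) = Q u v

/-! ## Rank-one points of a system `F = (f₁, f₂)` on a manifold -/

/-- The differential of a real function at a point of a manifold, as a covector. -/
noncomputable def differentialAt {E : Type*} [NormedAddCommGroup E] [NormedSpace ℝ E]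
    {M : Type*} [TopologicalSpace M] [ChartedSpace E M] (f : M → ℝ) (p : M) :
    TangentSpace 𝓘(ℝ, E) p →ₗ[ℝ] ℝ :=
  ContinuousLinearMap.toLinearMap (mfderiv 𝓘(ℝ, E) 𝓘(ℝ, ℝ) f p)

/-- The second derivative of `g : E → ℝ` at `x` as a bilinear form. -/
noncomputable def secondDerivForm {E : Type*} [NormedAddCommGroup E] [NormedSpace ℝ E]
    (g : E → ℝ) (x : E) : LinearMap.BilinForm ℝ E :=
  LinearMap.mk₂ ℝ (fun u v : E => fderiv ℝ (fderiv ℝ g) x u v)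
    (by intros; simp) (by intros; simp) (by intros; simp) (by intros; simp)

/-- The second derivative of `f` at `p` in the preferred chart at `p`, which is also the chart
through which the tangent space at `p` is identified with `E`. -/
noncomputable def hessianAt {E : Type*} [NormedAddCommGroup E] [NormedSpace ℝ E]
    {M : Type*} [TopologicalSpace M] [ChartedSpace E M] (f : M → ℝ) (p : M) :
    LinearMap.BilinForm ℝ (TangentSpace 𝓘(ℝ, E) p) :=
  secondDerivForm (E := E) (f ∘ (chartAt E p).symm) (chartAt E p p)

/-- The point `p` has rank one: the Jacobian `(df₁, df₂)` at `p` has rank one. -/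
def IsRankOnePoint {E : Type*} [NormedAddCommGroup E] [NormedSpace ℝ E]
    {M : Type*} [TopologicalSpace M] [ChartedSpace E M] (F : M → ℝ × ℝ) (p : M) : Prop :=
  Module.finrank ℝ (LinearMap.range
    ((differentialAt (E := E) (fun x => (F x).1) p).prod
      (differentialAt (E := E) (fun x => (F x).2) p))) = 1

/-- The tangent line `L_p`, spanned by the Hamiltonian vectors of `f₁` and `f₂` at `p`. -/
noncomputable def orbitLine {E : Type*} [NormedAddCommGroup E] [NormedSpace ℝ E]
    {M : Type*} [TopologicalSpace M] [ChartedSpace E M]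
    (ω : ∀ p : M, LinearMap.BilinForm ℝ (TangentSpace 𝓘(ℝ, E) p)) (F : M → ℝ × ℝ) (p : M) :
    Submodule ℝ (TangentSpace 𝓘(ℝ, E) p) :=
  hamiltonianSpan (ω p) (differentialAt (fun x => (F x).1) p) (differentialAt (fun x => (F x).2) p)

/-- `(a, b) ≠ (0, 0)` and `a df₁(p) + b df₂(p) = 0`. -/
def IsDifferentialRelation {E : Type*} [NormedAddCommGroup E] [NormedSpace ℝ E]
    {M : Type*} [TopologicalSpace M] [ChartedSpace E M] (F : M → ℝ × ℝ) (p : M) (a b : ℝ) : Prop :=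
  (a, b) ≠ (0, 0) ∧
    a • differentialAt (E := E) (fun x => (F x).1) p +
      b • differentialAt (E := E) (fun x => (F x).2) p = 0

/-- The combination `a d²f₁(p) + b d²f₂(p)`. -/
noncomputable def hessianCombination {E : Type*} [NormedAddCommGroup E] [NormedSpace ℝ E]
    {M : Type*} [TopologicalSpace M] [ChartedSpace E M] (F : M → ℝ × ℝ) (p : M) (a b : ℝ) :
    LinearMap.BilinForm ℝ (TangentSpace 𝓘(ℝ, E) p) :=
  a • hessianAt (E := E) (fun x => (F x).1) p + b • hessianAt (E := E) (fun x => (F x).2) p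

/-- A rank-one point `p` is nondegenerate if, for a nontrivial relation
`a df₁(p) + b df₂(p) = 0` (unique up to scaling), the form `a d²f₁(p) + b d²f₂(p)` descends to an
invertible form on `L_p^⊥ / L_p`. -/
def IsNondegenerateRankOnePoint {E : Type*} [NormedAddCommGroup E] [NormedSpace ℝ E]
    {M : Type*} [TopologicalSpace M] [ChartedSpace E M]
    (ω : ∀ p : M, LinearMap.BilinForm ℝ (TangentSpace 𝓘(ℝ, E) p)) (F : M → ℝ × ℝ) (p : M) : Prop :=
  IsRankOnePoint (E := E) F p ∧
    ∃ a b : ℝ, IsDifferentialRelation (E := E) F p a b ∧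
      ∃ B : LinearMap.BilinForm ℝ (OrthoQuotient (ω p) (orbitLine ω F p)),
        FormDescendsTo (ω p) (orbitLine ω F p) (hessianCombination F p a b) B ∧ B.Nondegenerate

/-- A nondegenerate rank-one point `p` is of elliptic-regular type if the endomorphism of
`L_p^⊥ / L_p` induced by `ω_p⁻¹ (a d²f₁(p) + b d²f₂(p))` has (complex) eigenvalues `± i r` for some
nonzero real `r`. -/
def IsEllipticRegularPoint {E : Type*} [NormedAddCommGroup E] [NormedSpace ℝ E]
    [FiniteDimensional ℝ E] {M : Type*} [TopologicalSpace M] [ChartedSpace E M]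
    (ω : ∀ p : M, LinearMap.BilinForm ℝ (TangentSpace 𝓘(ℝ, E) p)) (F : M → ℝ × ℝ) (p : M) : Prop :=
  IsNondegenerateRankOnePoint ω F p ∧
    ∃ a b : ℝ, IsDifferentialRelation (E := E) F p a b ∧
      ∃ A : Module.End ℝ (TangentSpace 𝓘(ℝ, E) p),
        IsInverseFormComp (ω p) (hessianCombination F p a b) A ∧
        ∃ T : Module.End ℝ (OrthoQuotient (ω p) (orbitLine ω F p)),
          EndDescendsTo (ω p) (orbitLine ω F p) A T ∧
          haveI : FiniteDimensional ℝ (TangentSpace 𝓘(ℝ, E) p) :=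
            inferInstanceAs (FiniteDimensional ℝ E)
          ∃ r : ℝ, r ≠ 0 ∧
            (T.charpoly.map (algebraMap ℝ ℂ)).roots = {Complex.I * r, -(Complex.I * r)}

/-! ## The toric manifold of the octagon

The coordinates `z₁, …, z₈` are indexed by `0, …, 7 : Fin 8`, and addition in `Fin 8` is modulo 8.
-/

namespace Octagon

/-- The outer normal vectors of the octagon, starting at the left edge, counterclockwise. -/
def normal : Fin 8 → ℤ × ℤ :=
  ![(-1, 0), (-1, -1), (0, -1), (1, -1), (1, 0), (1, 1), (0, 1), (-1, 1)]

/-- The octagon is `{x | ⟨x, normal k⟩ ≤ offset k for all k}`. -/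
def offset : Fin 8 → ℝ := ![0, -1, 0, 2, 3, 5, 3, 2]

/-- The kernel of the map of tori `𝕋⁸ → 𝕋²` that sends the `k`-th generator to `normal k`. -/
def N : Subgroup (Fin 8 → Circle) where
  carrier := {s | ∏ k, s k ^ (normal k).1 = 1 ∧ ∏ k, s k ^ (normal k).2 = 1}
  one_mem' := by simp
  mul_mem' := by
    rintro s s' ⟨h1, h2⟩ ⟨h1', h2'⟩
    simp only [Set.mem_ofPred_eq, Pi.mul_apply, mul_zpow, Finset.prod_mul_distrib] at *
    simp [h1, h2, h1', h2']
  inv_mem' := by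
    rintro s ⟨h1, h2⟩
    simp only [Set.mem_ofPred_eq, Pi.inv_apply, inv_zpow, Finset.prod_inv_distrib] at *
    simp [h1, h2]

/-- The level set cut out of `ℂ⁸` by the six manifold equations. -/
def levelSet : Set (Fin 8 → ℂ) :=
  {z | ‖z 0‖ ^ 2 + ‖z 4‖ ^ 2 = 6 ∧
    ‖z 1‖ ^ 2 + ‖z 4‖ ^ 2 + ‖z 6‖ ^ 2 = 10 ∧
    ‖z 2‖ ^ 2 + ‖z 6‖ ^ 2 = 6 ∧
    ‖z 3‖ ^ 2 - ‖z 4‖ ^ 2 + ‖z 6‖ ^ 2 = 4 ∧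
    ‖z 4‖ ^ 2 - ‖z 5‖ ^ 2 + ‖z 6‖ ^ 2 = 2 ∧
    ‖z 4‖ ^ 2 - ‖z 6‖ ^ 2 + ‖z 7‖ ^ 2 = 4}

/-- `N` acts on the level set by coordinatewise multiplication. -/
noncomputable instance : MulAction N levelSet where
  smul s z := ⟨fun k => (s.1 k : ℂ) * z.1 k, by
    have h : ∀ k, ‖(s.1 k : ℂ) * z.1 k‖ = ‖z.1 k‖ := fun k => by
      rw [norm_mul, Circle.norm_coe, one_mul]
    simpa only [levelSet, Set.mem_ofPred_eq, h] using z.2⟩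
  one_smul z := Subtype.ext (funext fun k => by
    change ((1 : Circle) : ℂ) * z.1 k = z.1 k
    simp)
  mul_smul s s' z := Subtype.ext (funext fun k => by
    change ((s.1 k * s'.1 k : Circle) : ℂ) * z.1 k = s.1 k * (s'.1 k * z.1 k)
    simp [mul_assoc])

theorem smul_apply (s : N) (z : levelSet) (k : Fin 8) :
    (s • z).1 k = (s.1 k : ℂ) * z.1 k := rfl

theorem norm_smul_apply (s : N) (z : levelSet) (k : Fin 8) : ‖(s • z).1 k‖ = ‖z.1 k‖ := by
  rw [smul_apply, norm_mul, Circle.norm_coe, one_mul]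

instance : ContinuousConstSMul N levelSet where
  continuous_const_smul s := by
    refine continuous_induced_rng.2 (continuous_pi fun k => ?_)
    exact continuous_const.mul ((continuous_apply k).comp continuous_subtype_val)

/-- The manifold `M`: the quotient of the level set by `N`. -/
def M : Type := MulAction.orbitRel.Quotient N levelSet

instance : TopologicalSpace M :=
  inferInstanceAs (TopologicalSpace (Quotient (MulAction.orbitRel N levelSet)))

/-- The quotient map. -/
noncomputable def proj (z : levelSet) : M := Quotient.mk (MulAction.orbitRel N levelSet) z

/-- A function on the level set that is invariant under `N` descends to `M`. -/
noncomputable def descend {α : Type*} (f : levelSet → α) (hf : ∀ (s : N) z, f (s • z) = f z) : M → α :=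
  Quotient.lift f (by
    rintro _ z ⟨s, rfl⟩
    exact hf s z)

theorem descend_proj {α : Type*} (f : levelSet → α) (hf : ∀ (s : N) z, f (s • z) = f z)
    (z : levelSet) : descend f hf (proj z) = f z := rfl

theorem continuous_coord (k : Fin 8) : Continuous fun z : levelSet => z.1 k :=
  (continuous_apply k).comp continuous_subtype_val

theorem isOpenQuotientMap_proj : IsOpenQuotientMap proj :=
  MulAction.isOpenQuotientMap_quotientMk

theorem proj_surjective : Function.Surjective proj := isOpenQuotientMap_proj.surjective

theorem proj_smul (s : N) (z : levelSet) : proj (s • z) = proj z :=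
  Quotient.sound (s := MulAction.orbitRel N levelSet) ⟨s, rfl⟩

/-! ### The eight charts -/

/-- The indices other than `ν` and `ν + 1`. -/
def others (ν : Fin 8) : Finset (Fin 8) := Finset.univ.filter fun k => k ≠ ν ∧ k ≠ ν + 1

/-- The coefficients of `normal k = coeffA ν k • normal ν + coeffB ν k • normal (ν + 1)`. -/
def coeffA (ν k : Fin 8) : ℤ :=
  (normal k).1 * (normal (ν + 1)).2 - (normal k).2 * (normal (ν + 1)).1

/-- See `coeffA`. -/
def coeffB (ν k : Fin 8) : ℤ :=
  (normal ν).1 * (normal k).2 - (normal ν).2 * (normal k).1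

theorem normal_eq (ν k : Fin 8) :
    normal k = coeffA ν k • normal ν + coeffB ν k • normal (ν + 1) := by
  revert ν k; decide

/-- The phase `z / |z|` of a complex number (with the value `0` at `0`). -/
noncomputable def phase (z : ℂ) : ℂ := z / ‖z‖

/-- The coordinates `(z_ν, z_{ν+1})` of the point in the `N`-orbit of `z` whose other six
coordinates are positive. -/
noncomputable def coordMap (ν : Fin 8) (z : Fin 8 → ℂ) : ℂ × ℂ :=
  (z ν * ∏ k ∈ others ν, phase (z k) ^ coeffA ν k,
    z (ν + 1) * ∏ k ∈ others ν, phase (z k) ^ coeffB ν k)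

/-- The value of `|z_k|²` on the level set, in terms of `(z_ν, z_{ν+1}) = w`. -/
noncomputable def sqModulus (ν k : Fin 8) (w : ℂ × ℂ) : ℝ :=
  2 * (offset k - coeffA ν k * offset ν - coeffB ν k * offset (ν + 1)) +
    coeffA ν k * ‖w.1‖ ^ 2 + coeffB ν k * ‖w.2‖ ^ 2

/-- The point with coordinates `(z_ν, z_{ν+1}) = w` whose other six coordinates are positive and
determined by the manifold equations. -/
noncomputable def sectionMap (ν : Fin 8) (w : ℂ × ℂ) : Fin 8 → ℂ := fun k =>
  if k = ν then w.1 else if k = ν + 1 then w.2 else ((√(sqModulus ν k w) : ℝ) : ℂ)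

/-- The range of the `ν`-th chart. -/
def chartTarget (ν : Fin 8) : Set (ℂ × ℂ) := {w | ∀ k ∈ others ν, 0 < sqModulus ν k w}

/-- The domain of the `ν`-th chart, where at most `z_ν` and `z_{ν+1}` vanish. -/
def chartSource (ν : Fin 8) : Set M := proj '' {z | ∀ k ∈ others ν, z.1 k ≠ 0}

theorem mem_others {ν k : Fin 8} : k ∈ others ν ↔ k ≠ ν ∧ k ≠ ν + 1 := by simp [others]

theorem prod_eq_others {G : Type*} [CommMonoid G] (ν : Fin 8) (g : Fin 8 → G) :
    ∏ k, g k = g ν * (g (ν + 1) * ∏ k ∈ others ν, g k) := by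
  have h : (Finset.univ : Finset (Fin 8)) = insert ν (insert (ν + 1) (others ν)) := by
    revert ν; decide
  have h1 : ν ∉ insert (ν + 1) (others ν) := by revert ν; decide
  have h2 : ν + 1 ∉ others ν := by revert ν; decide
  rw [h, Finset.prod_insert h1, Finset.prod_insert h2]

theorem coeff_values (ν : Fin 8) : coeffA ν ν = 1 ∧ coeffB ν ν = 0 ∧ coeffA ν (ν + 1) = 0 ∧
    coeffB ν (ν + 1) = 1 := by
  revert ν; decide

theorem mul_prod_coeffA (s : N) (ν : Fin 8) : s.1 ν * ∏ k ∈ others ν, s.1 k ^ coeffA ν k = 1 := by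
  obtain ⟨h1, h2⟩ := s.2
  have h : ∏ k, s.1 k ^ coeffA ν k = 1 := by
    simp only [coeffA, zpow_sub, zpow_mul, Finset.prod_mul_distrib, Finset.prod_inv_distrib,
      Finset.prod_zpow, h1, h2, one_zpow, inv_one, mul_one]
  rw [prod_eq_others ν] at h
  simpa [coeff_values ν] using h

theorem mul_prod_coeffB (s : N) (ν : Fin 8) :
    s.1 (ν + 1) * ∏ k ∈ others ν, s.1 k ^ coeffB ν k = 1 := by
  obtain ⟨h1, h2⟩ := s.2
  have h : ∏ k, s.1 k ^ coeffB ν k = 1 := by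
    simp only [coeffB, mul_comm (normal ν).1, mul_comm (normal ν).2, zpow_sub, zpow_mul,
      Finset.prod_mul_distrib, Finset.prod_inv_distrib,
      Finset.prod_zpow, h1, h2, one_zpow, inv_one, mul_one]
  rw [prod_eq_others ν] at h
  simpa [coeff_values ν] using h

theorem coe_prod (t : Finset (Fin 8)) (g : Fin 8 → Circle) :
    ((∏ k ∈ t, g k : Circle) : ℂ) = ∏ k ∈ t, (g k : ℂ) := map_prod Circle.coeHom g t

theorem phase_mul (c : Circle) (z : ℂ) : phase (c * z) = c * phase z := by
  simp only [phase, norm_mul, Circle.norm_coe, one_mul, mul_div_assoc]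

theorem coordMap_smul (ν : Fin 8) (s : N) (z : levelSet) :
    coordMap ν (s • z).1 = coordMap ν z.1 := by
  have hA : (s.1 ν : ℂ) * ∏ k ∈ others ν, (s.1 k : ℂ) ^ coeffA ν k = 1 := by
    simpa [coe_prod] using congrArg (fun c : Circle => (c : ℂ)) (mul_prod_coeffA s ν)
  have hB : (s.1 (ν + 1) : ℂ) * ∏ k ∈ others ν, (s.1 k : ℂ) ^ coeffB ν k = 1 := by
    simpa [coe_prod] using congrArg (fun c : Circle => (c : ℂ)) (mul_prod_coeffB s ν)
  simp only [coordMap, smul_apply, phase_mul, mul_zpow, Finset.prod_mul_distrib]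
  refine Prod.ext ?_ ?_
  · simp only
    linear_combination (z.1 ν * ∏ k ∈ others ν, phase (z.1 k) ^ coeffA ν k) * hA
  · simp only
    linear_combination (z.1 (ν + 1) * ∏ k ∈ others ν, phase (z.1 k) ^ coeffB ν k) * hB

theorem norm_phase {z : ℂ} (hz : z ≠ 0) : ‖phase z‖ = 1 := by
  simp [phase, hz]

theorem sq_norm_eq (z : levelSet) (ν k : Fin 8) :
    ‖z.1 k‖ ^ 2 = sqModulus ν k (z.1 ν, z.1 (ν + 1)) := by
  obtain ⟨z, hA, hB, hC, hD, hE, hF⟩ := z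
  have key : ∀ k, ‖z k‖ ^ 2 =
      2 * (offset k - (normal k).1 * (‖z 0‖ ^ 2 / 2) - (normal k).2 * (‖z 2‖ ^ 2 / 2)) := by
    intro k
    fin_cases k <;> simp [offset, normal] <;> linarith
  have hn1 := congrArg Prod.fst (normal_eq ν k)
  have hn2 := congrArg Prod.snd (normal_eq ν k)
  simp only [Prod.fst_add, Prod.snd_add, Prod.smul_fst, Prod.smul_snd, smul_eq_mul] at hn1 hn2
  have hn1' : ((normal k).1 : ℝ) =
      coeffA ν k * (normal ν).1 + coeffB ν k * (normal (ν + 1)).1 := by exact_mod_cast hn1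
  have hn2' : ((normal k).2 : ℝ) =
      coeffA ν k * (normal ν).2 + coeffB ν k * (normal (ν + 1)).2 := by exact_mod_cast hn2
  simp only [sqModulus]
  rw [key k, key ν, key (ν + 1), hn1', hn2']
  ring

theorem sqModulus_congr (ν k : Fin 8) {w w' : ℂ × ℂ} (h1 : ‖w.1‖ = ‖w'.1‖) (h2 : ‖w.2‖ = ‖w'.2‖) :
    sqModulus ν k w = sqModulus ν k w' := by simp [sqModulus, h1, h2]

theorem norm_coordMap {ν : Fin 8} {z : Fin 8 → ℂ} (hz : ∀ k ∈ others ν, z k ≠ 0) :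
    ‖(coordMap ν z).1‖ = ‖z ν‖ ∧ ‖(coordMap ν z).2‖ = ‖z (ν + 1)‖ := by
  have h : ∀ c : Fin 8 → ℤ, ‖∏ k ∈ others ν, phase (z k) ^ c k‖ = 1 := fun c => by
    rw [norm_prod]
    exact Finset.prod_eq_one fun k hk => by rw [norm_zpow, norm_phase (hz k hk), one_zpow]
  simp [coordMap, h]

theorem add_one_ne (ν : Fin 8) : ν + 1 ≠ ν := by revert ν; decide

theorem sqModulus_self (ν : Fin 8) (w : ℂ × ℂ) :
    sqModulus ν ν w = ‖w.1‖ ^ 2 ∧ sqModulus ν (ν + 1) w = ‖w.2‖ ^ 2 := by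
  obtain ⟨h1, h2, h3, h4⟩ := coeff_values ν
  simp [sqModulus, h1, h2, h3, h4]

theorem sq_norm_sectionMap {ν : Fin 8} {w : ℂ × ℂ} (hw : w ∈ chartTarget ν) (k : Fin 8) :
    ‖sectionMap ν w k‖ ^ 2 = sqModulus ν k w := by
  unfold sectionMap
  split_ifs with h1 h2
  · rw [h1, (sqModulus_self ν w).1]
  · rw [h2, (sqModulus_self ν w).2]
  · have := hw k (mem_others.2 ⟨h1, h2⟩)
    rw [Complex.norm_real, Real.norm_of_nonneg (Real.sqrt_nonneg _), Real.sq_sqrt this.le]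

theorem sectionMap_mem {ν : Fin 8} {w : ℂ × ℂ} (hw : w ∈ chartTarget ν) :
    sectionMap ν w ∈ levelSet := by
  simp only [levelSet, Set.mem_ofPred_eq, sq_norm_sectionMap hw]
  fin_cases ν <;> refine ⟨?_, ?_, ?_, ?_, ?_, ?_⟩ <;>
    simp [sqModulus, coeffA, coeffB, normal, offset] <;> ring

theorem coordMap_sectionMap {ν : Fin 8} {w : ℂ × ℂ} (hw : w ∈ chartTarget ν) :
    coordMap ν (sectionMap ν w) = w := by
  have h : ∀ k ∈ others ν, phase (sectionMap ν w k) = 1 := fun k hk => by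
    have h0 := Real.sqrt_pos.2 (hw k hk)
    rw [sectionMap, if_neg (mem_others.1 hk).1, if_neg (mem_others.1 hk).2, phase,
      Complex.norm_real, Real.norm_of_nonneg h0.le, div_self (by exact_mod_cast h0.ne')]
  have h' : ∀ c : Fin 8 → ℤ, ∏ k ∈ others ν, phase (sectionMap ν w k) ^ c k = 1 := fun c =>
    Finset.prod_eq_one fun k hk => by rw [h k hk, one_zpow]
  simp only [coordMap, h', mul_one]
  simp [sectionMap]

theorem coordMap_mem {ν : Fin 8} {z : levelSet} (hz : ∀ k ∈ others ν, z.1 k ≠ 0) :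
    coordMap ν z.1 ∈ chartTarget ν := fun k hk => by
  rw [sqModulus_congr ν k (w' := (z.1 ν, z.1 (ν + 1))) (norm_coordMap hz).1 (norm_coordMap hz).2,
    ← sq_norm_eq z ν k]
  exact pow_pos (norm_pos_iff.2 (hz k hk)) 2

/-- On the domain of the `ν`-th chart, the section at the coordinates of `z` lies in the orbit of
`z`. -/
theorem exists_smul_eq {ν : Fin 8} {z : levelSet} (hz : ∀ k ∈ others ν, z.1 k ≠ 0) :
    ∃ s : N, (s • z).1 = sectionMap ν (coordMap ν z.1) := by
  classical
  let u : Fin 8 → Circle := fun k =>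
    if h : z.1 k = 0 then 1 else ⟨phase (z.1 k), mem_sphere_zero_iff_norm.2 (norm_phase h)⟩
  have hu : ∀ k ∈ others ν, (u k : ℂ) = phase (z.1 k) := fun k hk => by
    simp [u, hz k hk]
  let s : Fin 8 → Circle := fun k =>
    if k = ν then ∏ j ∈ others ν, u j ^ coeffA ν j
    else if k = ν + 1 then ∏ j ∈ others ν, u j ^ coeffB ν j
    else (u k)⁻¹
  have hsν : s ν = ∏ j ∈ others ν, u j ^ coeffA ν j := by simp [s]
  have hsν' : s (ν + 1) = ∏ j ∈ others ν, u j ^ coeffB ν j := by simp [s]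
  have hso : ∀ k ∈ others ν, s k = (u k)⁻¹ := fun k hk => by
    simp [s, (mem_others.1 hk).1, (mem_others.1 hk).2]
  have hprod : ∀ c : Fin 8 → ℤ, (∀ k, c k = coeffA ν k * c ν + coeffB ν k * c (ν + 1)) →
      ∏ k, s k ^ c k = 1 := fun c hc => by
    have h : ∏ k ∈ others ν, s k ^ c k =
        ∏ k ∈ others ν, (u k)⁻¹ ^ (coeffA ν k * c ν + coeffB ν k * c (ν + 1)) :=
      Finset.prod_congr rfl fun k hk => by rw [hso k hk, hc k]
    rw [prod_eq_others ν, hsν, hsν', h]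
    simp only [← Finset.prod_zpow, ← Finset.prod_mul_distrib]
    refine Finset.prod_eq_one fun k _ => ?_
    rw [inv_zpow, zpow_add, zpow_mul, zpow_mul]
    group
  have hs : s ∈ N := by
    refine ⟨hprod (fun k => (normal k).1) fun k => ?_, hprod (fun k => (normal k).2) fun k => ?_⟩
    · simpa using congrArg Prod.fst (normal_eq ν k)
    · simpa using congrArg Prod.snd (normal_eq ν k)
  refine ⟨⟨s, hs⟩, funext fun k => ?_⟩
  rw [smul_apply]
  simp only [sectionMap]
  split_ifs with h1 h2
  · subst h1
    have : (s k : ℂ) = ∏ j ∈ others k, phase (z.1 j) ^ coeffA k j := by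
      rw [hsν, coe_prod]
      exact Finset.prod_congr rfl fun j hj => by simp [hu j hj]
    simp [coordMap, this, mul_comm]
  · subst h2
    have : (s (ν + 1) : ℂ) = ∏ j ∈ others ν, phase (z.1 j) ^ coeffB ν j := by
      rw [hsν', coe_prod]
      exact Finset.prod_congr rfl fun j hj => by simp [hu j hj]
    simp [coordMap, this, mul_comm]
  · have hk := mem_others.2 ⟨h1, h2⟩
    rw [sqModulus_congr ν k (w' := (z.1 ν, z.1 (ν + 1))) (norm_coordMap hz).1
      (norm_coordMap hz).2, ← sq_norm_eq z ν k, Real.sqrt_sq (norm_nonneg _)]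
    have hn : (‖z.1 k‖ : ℂ) ≠ 0 := by simpa using hz k hk
    have hz' := hz k hk
    simp only [hso k hk, Circle.coe_inv, hu k hk, phase]
    field_simp

theorem mem_chartSource {ν : Fin 8} {z : levelSet} :
    proj z ∈ chartSource ν ↔ ∀ k ∈ others ν, z.1 k ≠ 0 := by
  refine ⟨?_, fun h => ⟨z, h, rfl⟩⟩
  rintro ⟨z', hz', h⟩ k hk
  obtain ⟨s, rfl⟩ : ∃ s : N, s • z = z' := Quotient.exact (s := MulAction.orbitRel N levelSet) h
  have := hz' k hk
  rw [smul_apply] at this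
  exact right_ne_zero_of_mul this

/-- The inverse of the `ν`-th chart (with an arbitrary value outside `chartTarget ν`). -/
noncomputable def chartInv (ν : Fin 8) (w : ℂ × ℂ) : M :=
  open Classical in
  if h : sectionMap ν w ∈ levelSet then proj ⟨sectionMap ν w, h⟩
  else proj ⟨sectionMap 0 (0, 0), sectionMap_mem (by
    intro k hk
    fin_cases k <;> simp_all [others, sqModulus, coeffA, coeffB, normal, offset]; norm_num)⟩

theorem chartInv_eq {ν : Fin 8} {w : ℂ × ℂ} (hw : w ∈ chartTarget ν) :
    chartInv ν w = proj ⟨sectionMap ν w, sectionMap_mem hw⟩ := by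
  rw [chartInv, dif_pos (sectionMap_mem hw)]

theorem continuous_sqModulus (ν k : Fin 8) : Continuous (sqModulus ν k) := by
  unfold sqModulus
  fun_prop

theorem continuous_sectionMap (ν : Fin 8) : Continuous (sectionMap ν) := by
  refine continuous_pi fun k => ?_
  unfold sectionMap
  have := continuous_sqModulus ν k
  split_ifs <;> fun_prop

theorem isOpen_chartTarget (ν : Fin 8) : IsOpen (chartTarget ν) := by
  have : chartTarget ν = ⋂ k ∈ others ν, {w | 0 < sqModulus ν k w} := by
    ext w; simp [chartTarget]
  rw [this]
  exact isOpen_biInter_finset fun k _ => isOpen_lt continuous_const (continuous_sqModulus ν k)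

theorem isOpen_chartSource (ν : Fin 8) : IsOpen (chartSource ν) := by
  refine isOpenQuotientMap_proj.isOpenMap _ ?_
  have : {z : levelSet | ∀ k ∈ others ν, z.1 k ≠ 0} =
      ⋂ k ∈ others ν, {z : levelSet | z.1 k ≠ 0} := by
    ext w; simp
  rw [this]
  exact isOpen_biInter_finset fun k _ => isOpen_ne_fun (continuous_coord k) continuous_const

/-- The `ν`-th chart `[z] ↦ (z_ν, z_{ν+1})`, where the representative `z` is chosen such that its
other six coordinates are positive. -/
noncomputable def chart (ν : Fin 8) : OpenPartialHomeomorph M (ℂ × ℂ) where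
  toFun := descend (fun z => coordMap ν z.1) (coordMap_smul ν)
  invFun := chartInv ν
  source := chartSource ν
  target := chartTarget ν
  map_source' := by
    rintro _ ⟨z, hz, rfl⟩
    exact coordMap_mem hz
  map_target' := by
    intro w hw
    rw [chartInv_eq hw, mem_chartSource]
    intro k hk h
    have h1 := sq_norm_sectionMap hw k
    have h2 := hw k hk
    simp only at h
    rw [h] at h1
    simp at h1
    linarith
  left_inv' := by
    rintro _ ⟨z, hz, rfl⟩
    rw [descend_proj, chartInv_eq (coordMap_mem hz)]
    obtain ⟨s, hs⟩ := exists_smul_eq hz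
    rw [← proj_smul s z]
    exact congrArg proj (Subtype.ext hs.symm)
  right_inv' := by
    intro w hw
    rw [chartInv_eq hw, descend_proj]
    exact coordMap_sectionMap hw
  open_source := isOpen_chartSource ν
  open_target := isOpen_chartTarget ν
  continuousOn_toFun := by
    refine (isOpenQuotientMap_proj.isQuotientMap.continuousOn_isOpen_iff
      (f := proj) (g := descend (fun z => coordMap ν z.1) (coordMap_smul ν))
      (isOpen_chartSource ν)).2 ?_
    have hz := continuous_coord
    have hp : ∀ k ∈ others ν, ContinuousOn (fun z : levelSet => phase (z.1 k))
        (proj ⁻¹' chartSource ν) := fun k hk => by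
      refine ContinuousOn.div (hz k).continuousOn (Complex.continuous_ofReal.comp (hz k).norm).continuousOn fun z hz => ?_
      simpa using mem_chartSource.1 hz k hk
    have hc : ∀ c : Fin 8 → ℤ, ContinuousOn
        (fun z : levelSet => ∏ k ∈ others ν, phase (z.1 k) ^ c k) (proj ⁻¹' chartSource ν) :=
      fun c => continuousOn_finsetProd _ fun k hk => (hp k hk).zpow₀ _ fun z hz =>
        Or.inl (norm_ne_zero_iff.1 (by rw [norm_phase (mem_chartSource.1 hz k hk)]; simp))
    change ContinuousOn (fun z : levelSet => coordMap ν z.1) _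
    exact ContinuousOn.prodMk ((hz _).continuousOn.mul (hc _))
      ((hz _).continuousOn.mul (hc _))
  continuousOn_invFun := by
    rw [continuousOn_iff_continuous_domRestrict]
    have : (chartTarget ν).domRestrict (chartInv ν) =
        fun w : chartTarget ν => proj ⟨sectionMap ν w.1, sectionMap_mem w.2⟩ :=
      funext fun w => chartInv_eq w.2
    rw [this]
    exact isOpenQuotientMap_proj.continuous.comp
      (((continuous_sectionMap ν).comp continuous_subtype_val).subtype_mk _)

/-- At most two coordinates of a point of the level set vanish, and if two do, they are
consecutive. -/
theorem zero_adjacent (z : levelSet) (i j : Fin 8) (hi : z.1 i = 0) (hj : z.1 j = 0) :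
    j = i ∨ j = i + 1 ∨ i = j + 1 := by
  obtain ⟨z, hA, hB, hC, hD, hE, hF⟩ := z
  replace hi : ‖z i‖ ^ 2 = 0 := by simpa using hi
  replace hj : ‖z j‖ ^ 2 = 0 := by simpa using hj
  have h := fun k => sq_nonneg ‖z k‖
  generalize hr : (fun k => ‖z k‖ ^ 2) = r
  have hr' : ∀ k, ‖z k‖ ^ 2 = r k := fun k => by rw [← hr]
  simp only [hr'] at hA hB hC hD hE hF hi hj h
  have h0 := h 0
  have h1 := h 1
  have h2 := h 2
  have h3 := h 3
  have h4 := h 4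
  have h5 := h 5
  have h6 := h 6
  have h7 := h 7
  clear hr hr' h
  fin_cases i <;> fin_cases j <;> first
    | decide
    | (exfalso; simp only [Fin.reduceFinMk, Fin.zero_eta, Fin.mk_one] at hi hj; linarith)

theorem exists_mem_chartSource (p : M) : ∃ ν, p ∈ chartSource ν := by
  obtain ⟨z, rfl⟩ := proj_surjective p
  simp only [mem_chartSource, mem_others]
  have key : ∀ Z : Fin 8 → Bool,
      (∀ i j, Z i = true → Z j = true → j = i ∨ j = i + 1 ∨ i = j + 1) →
      ∃ ν, ∀ k, k ≠ ν ∧ k ≠ ν + 1 → Z k = false := by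
    intro Z hZ
    by_cases h : ∃ i, Z i = true
    · obtain ⟨i, hi⟩ := h
      by_cases h1 : Z (i - 1) = true
      · refine ⟨i - 1, fun k hk => ?_⟩
        by_contra h2
        have h3 := hZ i k hi (by simpa using h2)
        have h4 := hZ (i - 1) k h1 (by simpa using h2)
        clear hZ hi h1 h2
        revert i k; decide
      · refine ⟨i, fun k hk => ?_⟩
        by_contra h2
        have h3 := hZ i k hi (by simpa using h2)
        have h4 : k ≠ i - 1 := by
          rintro rfl
          exact h1 (by simpa using h2)
        clear hZ hi h1 h2
        revert i k; decide
    · exact ⟨0, fun k _ => by simpa using fun hk => h ⟨k, hk⟩⟩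
  classical
  obtain ⟨ν, hν⟩ := key (fun k => decide (z.1 k = 0)) (by simpa using zero_adjacent z)
  exact ⟨ν, fun k hk => by simpa using hν k hk⟩

/-- The index of the preferred chart at a point. -/
noncomputable def chartIndex (p : M) : Fin 8 := (exists_mem_chartSource p).choose

noncomputable instance : ChartedSpace (ℂ × ℂ) M where
  atlas := Set.range chart
  chartAt p := chart (chartIndex p)
  mem_chart_source p := (exists_mem_chartSource p).choose_spec
  chart_mem_atlas _ := ⟨_, rfl⟩

theorem chartAt_eq (p : M) : chartAt (ℂ × ℂ) p = chart (chartIndex p) := rfl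

theorem contDiffAt_sectionMap {ν : Fin 8} {w : ℂ × ℂ} (hw : w ∈ chartTarget ν) :
    ContDiffAt ℝ ((⊤ : ℕ∞) : WithTop ℕ∞) (sectionMap ν) w := by
  have h1 : ContDiffAt ℝ ((⊤ : ℕ∞) : WithTop ℕ∞) (fun w : ℂ × ℂ => w.1) w := contDiffAt_fst
  have h2 : ContDiffAt ℝ ((⊤ : ℕ∞) : WithTop ℕ∞) (fun w : ℂ × ℂ => w.2) w := contDiffAt_snd
  refine contDiffAt_pi.2 fun k => ?_
  by_cases hk1 : k = ν
  · simpa only [sectionMap, hk1, if_true] using h1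
  by_cases hk2 : k = ν + 1
  · simpa only [sectionMap, hk1, hk2, add_one_ne, if_true, if_false] using h2
  simp only [sectionMap, hk1, hk2, if_false]
  have hs : ContDiffAt ℝ ((⊤ : ℕ∞) : WithTop ℕ∞) (sqModulus ν k) w := by
    unfold sqModulus
    exact (contDiffAt_const.add (contDiffAt_const.mul (h1.norm_sq ℝ))).add
      (contDiffAt_const.mul (h2.norm_sq ℝ))
  exact Complex.ofRealCLM.contDiff.contDiffAt.comp w
    (hs.sqrt (hw k (mem_others.2 ⟨hk1, hk2⟩)).ne')

theorem contDiffAt_phase_zpow {z : ℂ} (hz : z ≠ 0) (n : ℤ) :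
    ContDiffAt ℝ ((⊤ : ℕ∞) : WithTop ℕ∞) (fun z => phase z ^ n) z := by
  have hp : ContDiffAt ℝ ((⊤ : ℕ∞) : WithTop ℕ∞) phase z := by
    unfold phase
    exact contDiffAt_id.mul ((Complex.ofRealCLM.contDiff.contDiffAt.comp z
      (contDiffAt_norm ℝ hz)).inv (by simpa using hz))
  have h0 : phase z ≠ 0 := norm_ne_zero_iff.1 (by rw [norm_phase hz]; simp)
  cases n with
  | ofNat n => simpa using hp.pow n
  | negSucc n =>
    simp only [zpow_negSucc]
    exact (hp.pow (n + 1)).inv (pow_ne_zero _ h0)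

theorem contDiffAt_coordMap {ν : Fin 8} {z : Fin 8 → ℂ} (hz : ∀ k ∈ others ν, z k ≠ 0) :
    ContDiffAt ℝ ((⊤ : ℕ∞) : WithTop ℕ∞) (coordMap ν) z := by
  have hc : ∀ c : Fin 8 → ℤ, ContDiffAt ℝ ((⊤ : ℕ∞) : WithTop ℕ∞)
      (fun z : Fin 8 → ℂ => ∏ k ∈ others ν, phase (z k) ^ c k) z := fun c =>
    contDiffAt_prod fun k hk =>
      (contDiffAt_phase_zpow (hz k hk) (c k)).comp z (contDiffAt_apply ℝ ℂ k z)
  unfold coordMap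
  exact ((contDiffAt_apply ℝ ℂ _ z).mul (hc _)).prodMk ((contDiffAt_apply ℝ ℂ _ z).mul (hc _))

/-- `M` is a smooth manifold (of real dimension four). -/
instance : IsManifold 𝓘(ℝ, ℂ × ℂ) ((⊤ : ℕ∞) : WithTop ℕ∞) M := by
  refine isManifold_of_contDiffOn _ _ _ ?_
  rintro _ _ ⟨ν, rfl⟩ ⟨μ, rfl⟩ w ⟨hw, -⟩
  have hw1 : w ∈ chartTarget ν := hw.1
  have hw2 : chartInv ν w ∈ chartSource μ := hw.2
  rw [chartInv_eq hw1] at hw2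
  refine ContDiffAt.contDiffWithinAt ?_
  refine ((contDiffAt_coordMap (mem_chartSource.1 hw2)).comp w
    (contDiffAt_sectionMap hw1)).congr_of_eventuallyEq ?_
  filter_upwards [(isOpen_chartTarget ν).mem_nhds hw1] with w' hw'
  change descend (fun z => coordMap μ z.1) (coordMap_smul μ) (chartInv ν w') = _
  rw [chartInv_eq hw', descend_proj]
  rfl

/-! ### The symplectic form and the integrals -/

/-- The standard symplectic form `-(i/2) ∑ dz_k ∧ d\bar z_k` on `ℂ⁸`, i.e. the block diagonal matrix
with blocks `(0, -1; 1, 0)` in the coordinates `(x_k, y_k)`. -/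
noncomputable def stdForm : LinearMap.BilinForm ℝ (Fin 8 → ℂ) :=
  LinearMap.mk₂ ℝ (fun u v => ∑ k, ((u k).im * (v k).re - (u k).re * (v k).im))
    (fun u u' v => by
      rw [← Finset.sum_add_distrib]; refine Finset.sum_congr rfl fun k _ => ?_; simp; ring)
    (fun c u v => by
      rw [Finset.smul_sum]; refine Finset.sum_congr rfl fun k _ => ?_; simp; ring)
    (fun u v v' => by
      rw [← Finset.sum_add_distrib]; refine Finset.sum_congr rfl fun k _ => ?_; simp; ring)
    (fun c u v => by
      rw [Finset.smul_sum]; refine Finset.sum_congr rfl fun k _ => ?_; simp; ring)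

/-- The reduced symplectic form in the `ν`-th chart, at the point with coordinates `w`: the pull-back
of the standard form under `sectionMap ν`, since `sectionMap ν` followed by `proj` is the inverse of
the chart. -/
noncomputable def chartForm (ν : Fin 8) (w : ℂ × ℂ) : LinearMap.BilinForm ℝ (ℂ × ℂ) :=
  LinearMap.BilinForm.comp stdForm
    (fderiv ℝ (sectionMap ν) w).toLinearMap (fderiv ℝ (sectionMap ν) w).toLinearMap

/-- The reduced symplectic form `ω` on `M`, characterised by `proj^* ω = κ^* ω_st` for the inclusion
`κ` of the level set into `ℂ⁸`. -/
noncomputable def symplecticForm (p : M) :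
    LinearMap.BilinForm ℝ (TangentSpace 𝓘(ℝ, ℂ × ℂ) p) :=
  chartForm (chartIndex p) (chartAt (ℂ × ℂ) p p)

/-- `J[z] = |z₁|² / 2`. -/
noncomputable def J : M → ℝ :=
  descend (fun z => ‖z.1 0‖ ^ 2 / 2) (fun s z => by simp only [norm_smul_apply])

/-- `H[z] = |z₃|² / 2`. -/
noncomputable def H : M → ℝ :=
  descend (fun z => ‖z.1 2‖ ^ 2 / 2) (fun s z => by simp only [norm_smul_apply])

/-- The function `\bar z₂ \bar z₃ \bar z₄ z₆ z₇ z₈`. -/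
noncomputable def Z (z : Fin 8 → ℂ) : ℂ :=
  starRingEnd ℂ (z 1) * starRingEnd ℂ (z 2) * starRingEnd ℂ (z 3) * z 5 * z 6 * z 7

theorem Z_smul (s : N) (z : levelSet) : Z (s • z).1 = Z z.1 := by
  have h := congrArg (fun c : Circle => (c : ℂ)) s.2.2
  simp [Fin.prod_univ_eight, normal] at h
  simp only [Z, smul_apply, map_mul, ← Circle.coe_inv_eq_conj, Circle.coe_inv]
  linear_combination (starRingEnd ℂ (z.1 1) * starRingEnd ℂ (z.1 2) * starRingEnd ℂ (z.1 3) *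
    z.1 5 * z.1 6 * z.1 7) * h

/-- `X` is the real part of `Z`. -/
noncomputable def X : M → ℝ :=
  descend (fun z => (Z z.1).re) (fun s z => by rw [Z_smul])

/-- `H_t = (1 - 2t) H + t γ X`. -/
noncomputable def Ht (γ t : ℝ) (p : M) : ℝ := (1 - 2 * t) * H p + t * γ * X p

/-- `F_t = (J, H_t)`. -/
noncomputable def Ft (γ t : ℝ) (p : M) : ℝ × ℝ := (J p, Ht γ t p)

end Octagon

/-! On the level set $|z_1|^2+|z_5|^2=6$, so $J=\frac12|z_1|^2=3-\frac12|z_5|^2$. Thus $J=0$ means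
$z_1=0$ and $J=3$ means $z_5=0$. A coordinate that vanishes at $p$ is one of the two coordinates of
every chart around $p$. Call it $u$ and the other one $v$; then $J=K\pm\frac12|u|^2$ near $p$, and
$p$ lies on $u=0$.

The charts are Darboux charts: the remaining six coordinates of the section are real, so they
contribute nothing to the pull-back of $\omega_{st}$ (`chartForm_apply`). Moreover those six depend
on $u$ only through $|u|$. Since neither $H$ nor $X$ involves $z_1$ or $z_5$, the function $H_t$ is
even in $u$, and $dH_t(p)$ vanishes on the $u$-plane.

Consequently $dJ(p)=0$, and the relation between the differentials is $(\mu,\lambda)=(1,0)$. Rank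
one gives $dH_t(p)\neq0$, so $L_p$ is a line inside the $v$-plane, $L_p^\perp$ is the sum of $L_p$
and the $u$-plane, and $L_p^\perp/L_p$ is the $u$-plane (`exists_orthoQuotient_equiv`). There
$d^2J(p)$ becomes $\pm$ the Euclidean inner product, which is definite, and $\omega_p^{-1}d^2J(p)$
becomes multiplication by $\mp i$, with eigenvalues $\pm i$
(`exists_form_and_endomorphism_descend`). The second derivatives of $H_t$ never enter. -/

/-! ### Symplectic linear algebra of the plane and of `L^⊥ / L` -/

/-- The standard symplectic form `Im x Re y - Re x Im y` of the complex plane. -/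
def planeForm (x y : ℂ) : ℝ := x.im * y.re - x.re * y.im

theorem eq_zero_of_planeForm {x : ℂ} (h : ∀ y, planeForm x y = 0) : x = 0 := by
  have h1 := h 1
  have h2 := h Complex.I
  simp only [planeForm, Complex.one_re, Complex.one_im, Complex.I_re, Complex.I_im] at h1 h2
  exact Complex.ext (by simp only [Complex.zero_re]; linarith)
    (by simp only [Complex.zero_im]; linarith)

theorem exists_planeForm_eq (β : ℂ →ₗ[ℝ] ℝ) : ∃ h : ℂ, ∀ y, planeForm h y = β y := by
  -- Forced by pairing `h` with `1` and `I`, which gives `h.im` and `-h.re`.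
  refine ⟨⟨-β Complex.I, β 1⟩, fun y => ?_⟩
  have hy : y = y.re • (1 : ℂ) + y.im • Complex.I := by
    apply Complex.ext <;> simp
  conv_rhs => rw [hy, map_add, map_smul, map_smul]
  simp only [planeForm, smul_eq_mul]
  ring

/-- Up to sign `planeForm` is the determinant, so its vanishing means that the vectors are parallel:
a line in the plane is its own symplectic complement. -/
theorem exists_smul_of_planeForm_eq_zero {h x : ℂ} (hh : h ≠ 0) (hx : planeForm h x = 0) :
    ∃ r : ℝ, x = r • h := by
  have hn : h.re ^ 2 + h.im ^ 2 ≠ 0 := by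
    intro h0
    exact hh (Complex.ext (by simp only [Complex.zero_re]; nlinarith [sq_nonneg h.re, sq_nonneg h.im])
      (by simp only [Complex.zero_im]; nlinarith [sq_nonneg h.re, sq_nonneg h.im]))
  unfold planeForm at hx
  -- The factor is `⟨h, x⟩ / |h|²`, the coefficient of the orthogonal projection onto `h`.
  refine ⟨(h.re * x.re + h.im * x.im) / (h.re ^ 2 + h.im ^ 2), Complex.ext ?_ ?_⟩
  · simp only [Complex.real_smul, Complex.re_ofReal_mul]
    field_simp
    linear_combination h.im * hx
  · simp only [Complex.real_smul, Complex.im_ofReal_mul]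
    field_simp
    linear_combination (-h.re) * hx

/-- In the basis `1, I` the matrix is `(0, -c; c, 0)`, with trace `0` and determinant `c ^ 2`. -/
theorem charpoly_smul_I (c : ℝ) :
    (((LinearMap.mulLeft ℝ ((c : ℂ) * Complex.I)).charpoly).map (algebraMap ℝ ℂ)).roots =
      {Complex.I * c, -(Complex.I * c)} := by
  have h : (LinearMap.mulLeft ℝ ((c : ℂ) * Complex.I)).charpoly =
      Polynomial.X ^ 2 + Polynomial.C (c ^ 2) := by
    rw [← LinearMap.charpoly_toMatrix _ Complex.basisOneI, Matrix.charpoly_fin_two,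
      Matrix.trace_fin_two, Matrix.det_fin_two]
    simp [LinearMap.toMatrix_apply, pow_two]
  have h2 : (Polynomial.X ^ 2 + Polynomial.C (c ^ 2) : Polynomial ℝ).map (algebraMap ℝ ℂ) =
      (Polynomial.X - Polynomial.C (Complex.I * c)) *
        (Polynomial.X - Polynomial.C (-(Complex.I * c))) := by
    have hI : (Polynomial.C Complex.I : Polynomial ℂ) ^ 2 = -1 := by
      rw [← Polynomial.C_pow, Complex.I_sq]; simp
    simp only [Polynomial.map_add, Polynomial.map_pow, Polynomial.map_X, Polynomial.map_C,
      Complex.coe_algebraMap, Polynomial.C_pow, Polynomial.C_mul,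
      Polynomial.C_neg]
    linear_combination (Polynomial.C (c : ℂ) ^ 2) * hI
  rw [h, h2, Polynomial.roots_mul, Polynomial.roots_X_sub_C, Polynomial.roots_X_sub_C]
  · rfl
  · exact mul_ne_zero (Polynomial.X_sub_C_ne_zero _) (Polynomial.X_sub_C_ne_zero _)

/-- If `ω` is the standard form of `ℂ × ℂ` and `β` is a nonzero covector that vanishes on the first
factor, then the quotient `L^⊥ / L` for the line `L` of `β` is the first factor. -/
theorem exists_orthoQuotient_equiv {V : Type*} [AddCommGroup V] [Module ℝ V]
    (e : V ≃ₗ[ℝ] ℂ × ℂ) (ω : LinearMap.BilinForm ℝ V)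
    (hω : ∀ x y, ω x y = planeForm (e x).1 (e y).1 + planeForm (e x).2 (e y).2)
    {β : V →ₗ[ℝ] ℝ} (hβ : β ≠ 0) (hβe : ∀ u : ℂ, β (e.symm (u, 0)) = 0) :
    (∀ u : ℂ, e.symm (u, 0) ∈ ω.orthogonal (hamiltonianSpan ω 0 β)) ∧
    ∃ E : OrthoQuotient ω (hamiltonianSpan ω 0 β) ≃ₗ[ℝ] ℂ,
      ∀ x : ω.orthogonal (hamiltonianSpan ω 0 β), E (Submodule.Quotient.mk x) = (e x).1 := by
  -- The zero covector contributes only the zero vector, since `ω` is nondegenerate; what is used is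
  -- that both covectors vanish on the first factor, which puts `L` in the second factor.
  set L := hamiltonianSpan ω 0 β with hL
  have hL1 : ∀ x ∈ L, (e x).1 = 0 := by
    intro x hx
    refine Submodule.span_induction (p := fun x _ => (e x).1 = 0) ?_ (by simp) ?_ ?_ hx
    · intro v hv
      refine eq_zero_of_planeForm fun y => ?_
      have h := hω v (e.symm (y, 0))
      rw [LinearEquiv.apply_symm_apply] at h
      have h0 : ω v (e.symm (y, 0)) = 0 := by
        rcases hv with hv | hv
        · rw [hv]; rfl
        · rw [hv]; exact hβe y
      rw [h0] at h
      simpa [planeForm] using h.symm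
    · intro x y _ _ hx hy; simp [hx, hy]
    · intro a x _ hx; simp [hx]
  obtain ⟨h, hh⟩ := exists_planeForm_eq (β ∘ₗ e.symm.toLinearMap ∘ₗ LinearMap.inr ℝ ℂ ℂ)
  have hβh : ω (e.symm (0, h)) = β := by
    ext x
    rw [hω, LinearEquiv.apply_symm_apply, hh]
    have hx : x = e.symm ((e x).1, 0) + e.symm (0, (e x).2) := by
      rw [← map_add]; simp
    conv_rhs => rw [hx, map_add, hβe]
    simp [planeForm]
  have hmem : e.symm (0, h) ∈ L := Submodule.subset_span (Or.inr hβh)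
  have hne : h ≠ 0 := by
    rintro rfl
    exact hβ (by rw [← hβh]; ext x; simp [hω, planeForm])
  have hinl : ∀ u : ℂ, e.symm (u, 0) ∈ ω.orthogonal L := by
    intro u x hx
    change ω x _ = 0
    rw [hω, LinearEquiv.apply_symm_apply, hL1 x hx]
    simp [planeForm]
  refine ⟨hinl, ?_⟩
  let f : ω.orthogonal L →ₗ[ℝ] ℂ :=
    LinearMap.fst ℝ ℂ ℂ ∘ₗ e.toLinearMap ∘ₗ (ω.orthogonal L).subtype
  -- A vector of `L^⊥` with zero first component has its second component orthogonal to `h`, hence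
  -- on the line of `h`.
  have hker : L.submoduleOf (ω.orthogonal L) = LinearMap.ker f := by
    ext x
    refine ⟨fun hx => hL1 x hx, fun hx => ?_⟩
    have hx1 : (e x).1 = 0 := hx
    have hx2 := x.2 _ hmem
    change ω _ _ = 0 at hx2
    rw [hω, LinearEquiv.apply_symm_apply, hx1] at hx2
    obtain ⟨r, hr⟩ := exists_smul_of_planeForm_eq_zero hne
      (show planeForm h (e x).2 = 0 by simpa [planeForm] using hx2)
    have hx3 : (x : V) = r • e.symm (0, h) := by
      rw [← map_smul, LinearEquiv.eq_symm_apply]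
      exact Prod.ext (by simpa using hx1) hr
    change (x : V) ∈ L
    rw [hx3]
    exact L.smul_mem r hmem
  have hsurj : Function.Surjective f := fun u => ⟨⟨_, hinl u⟩, by simp [f]⟩
  exact ⟨(Submodule.quotEquivOfEq _ _ hker).trans (f.quotKerEquivOfSurjective hsurj), fun x => rfl⟩

/-- Under the identification of `L^⊥ / L` with the first factor, `Q` becomes `c` times the Euclidean
inner product. It equals `planeForm` composed in the second argument with multiplication by `-c *
I`, so this multiplication is the induced endomorphism. -/
theorem exists_form_and_endomorphism_descend {V : Type*} [AddCommGroup V] [Module ℝ V]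
    [FiniteDimensional ℝ V]
    (e : V ≃ₗ[ℝ] ℂ × ℂ) (ω : LinearMap.BilinForm ℝ V)
    (hω : ∀ x y, ω x y = planeForm (e x).1 (e y).1 + planeForm (e x).2 (e y).2)
    {β : V →ₗ[ℝ] ℝ} (hβ : β ≠ 0) (hβe : ∀ u : ℂ, β (e.symm (u, 0)) = 0)
    (Q : LinearMap.BilinForm ℝ V) {c : ℝ} (hc : c ≠ 0)
    (hQ : ∀ x y, Q x y = c * inner ℝ (e x).1 (e y).1) :
    (∃ B : LinearMap.BilinForm ℝ (OrthoQuotient ω (hamiltonianSpan ω 0 β)),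
      FormDescendsTo ω (hamiltonianSpan ω 0 β) Q B ∧ B.Nondegenerate) ∧
    ∃ A : Module.End ℝ V, IsInverseFormComp ω Q A ∧
      ∃ T : Module.End ℝ (OrthoQuotient ω (hamiltonianSpan ω 0 β)),
        EndDescendsTo ω (hamiltonianSpan ω 0 β) A T ∧
        ∃ r : ℝ, r ≠ 0 ∧
          (T.charpoly.map (algebraMap ℝ ℂ)).roots = {Complex.I * r, -(Complex.I * r)} := by
  obtain ⟨hinl, E, hE⟩ := exists_orthoQuotient_equiv e ω hω hβ hβe
  refine ⟨⟨c • (innerₗ ℂ).compl₁₂ E.toLinearMap E.toLinearMap, ?_, ?_⟩, ?_⟩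
  · intro u v
    simp [hE, hQ]
  · constructor
    · intro x hx
      have := hx x
      simpa [hc] using this
    · intro x hx
      have := hx x
      simpa [hc] using this
  · let m := LinearMap.mulLeft ℝ (((-c : ℝ) : ℂ) * Complex.I)
    -- `A` is multiplication by `-c * I` on the first factor and zero on the second, because `Q`
    -- ignores the second factor.
    refine ⟨e.symm.toLinearMap ∘ₗ LinearMap.inl ℝ ℂ ℂ ∘ₗ m ∘ₗ LinearMap.fst ℝ ℂ ℂ ∘ₗ e.toLinearMap,
      ?_, E.symm.conj m, ?_, -c, neg_ne_zero.2 hc, ?_⟩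
    · intro u v
      rw [hω, hQ]
      simp [m, planeForm, Complex.inner]
      ring
    · intro v
      refine ⟨hinl _, E.injective ?_⟩
      rw [hE]
      simp [LinearEquiv.conj_apply, hE]
    · rw [LinearEquiv.charpoly_conj]
      exact charpoly_smul_I (-c)

/-! ### Derivatives of even functions and of squared norms -/

/-- The first alternative is the default value of `mfderiv`. With it, the vanishing of a
differential can be read off in the chart without proving differentiability. -/
theorem differentialAt_eq_zero_or {E : Type*} [NormedAddCommGroup E] [NormedSpace ℝ E]
    {M : Type*} [TopologicalSpace M] [ChartedSpace E M] (f : M → ℝ) (p : M) :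
    differentialAt (E := E) f p = 0 ∨
      ∀ x : E, differentialAt (E := E) f p x =
        fderiv ℝ (f ∘ (chartAt E p).symm) (chartAt E p p) x := by
  by_cases h : MDifferentiableAt 𝓘(ℝ, E) 𝓘(ℝ, ℝ) f p
  · right
    intro x
    have h1 : (mfderiv 𝓘(ℝ, E) 𝓘(ℝ, ℝ) f p : E →L[ℝ] ℝ) =
        fderivWithin ℝ (writtenInExtChartAt 𝓘(ℝ, E) 𝓘(ℝ, ℝ) p f) (Set.range 𝓘(ℝ, E))
          (extChartAt 𝓘(ℝ, E) p p) := if_pos h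
    rw [ModelWithCorners.range_eq_univ, fderivWithin_univ] at h1
    exact congrArg (fun l : E →L[ℝ] ℝ => l x) h1
  · left
    unfold differentialAt
    rw [mfderiv_zero_of_not_mdifferentiableAt h]
    rfl

theorem differentialAt_apply_eq_zero {E : Type*} [NormedAddCommGroup E] [NormedSpace ℝ E]
    {M : Type*} [TopologicalSpace M] [ChartedSpace E M] {f : M → ℝ} {p : M} {x : E}
    (h : fderiv ℝ (f ∘ (chartAt E p).symm) (chartAt E p p) x = 0) :
    differentialAt (E := E) f p x = 0 := by
  rcases differentialAt_eq_zero_or (E := E) f p with h' | h'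
  · rw [h']; rfl
  · rw [h' x, h]

/-- The line derivatives along `x` and `-x` agree and are also opposite. Without differentiability,
`fderiv` is zero by default. -/
theorem fderiv_apply_eq_zero_of_even {E : Type*} [NormedAddCommGroup E] [NormedSpace ℝ E]
    {g : E → ℝ} {w x : E} (h : ∀ s : ℝ, g (w + s • -x) = g (w + s • x)) :
    fderiv ℝ g w x = 0 := by
  by_cases hg : DifferentiableAt ℝ g w
  · have h1 : lineDeriv ℝ g w (-x) = lineDeriv ℝ g w x := by
      simp only [lineDeriv, h]
    rw [lineDeriv_neg, hg.lineDeriv_eq_fderiv] at h1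
    linarith
  · rw [fderiv_zero_of_not_differentiableAt hg]; rfl

theorem hasFDerivAt_const_add_mul_sq_norm {E F : Type*} [NormedAddCommGroup E] [NormedSpace ℝ E]
    [NormedAddCommGroup F] [InnerProductSpace ℝ F] (π : E →L[ℝ] F) (K c : ℝ) (w : E) :
    HasFDerivAt (fun w => K + c * (‖π w‖ ^ 2 / 2)) (c • (innerSL ℝ (π w)).comp π) w := by
  have h := ((((π.hasFDerivAt (x := w)).norm_sq).mul_const (1 / 2)).const_mul c).const_add K
  rw [← Nat.cast_smul_eq_nsmul ℝ, smul_smul (1 / 2 : ℝ)] at h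
  rw [show (1 / 2 : ℝ) * ((2 : ℕ) : ℝ) = 1 by norm_num, one_smul] at h
  simpa only [div_eq_mul_inv, one_mul] using h

theorem fderiv_const_add_mul_sq_norm {E F : Type*} [NormedAddCommGroup E] [NormedSpace ℝ E]
    [NormedAddCommGroup F] [InnerProductSpace ℝ F] (π : E →L[ℝ] F) (K c : ℝ) (w : E) :
    fderiv ℝ (fun w => K + c * (‖π w‖ ^ 2 / 2)) w = c • (innerSL ℝ (π w)).comp π :=
  (hasFDerivAt_const_add_mul_sq_norm π K c w).fderiv

/-- The first derivative is a continuous linear function of `w`, hence its own derivative. -/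
theorem fderiv_fderiv_const_add_mul_sq_norm {E F : Type*} [NormedAddCommGroup E] [NormedSpace ℝ E]
    [NormedAddCommGroup F] [InnerProductSpace ℝ F] (π : E →L[ℝ] F) (K c : ℝ) (w x y : E) :
    fderiv ℝ (fderiv ℝ (fun w => K + c * (‖π w‖ ^ 2 / 2))) w x y = c * inner ℝ (π x) (π y) := by
  have h : fderiv ℝ (fun w => K + c * (‖π w‖ ^ 2 / 2)) =
      fun w => (c • ((ContinuousLinearMap.compL ℝ E F ℝ).flip π ∘L (innerSL ℝ ∘L π))) w := by
    funext w
    rw [fderiv_const_add_mul_sq_norm]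
    rfl
  rw [h, ContinuousLinearMap.fderiv]
  rfl

/-! ### The charts as Darboux charts, and the integrals in them -/

namespace Octagon

theorem fderiv_sectionMap_apply {ν : Fin 8} {w : ℂ × ℂ} (hw : w ∈ chartTarget ν) (x : ℂ × ℂ)
    (k : Fin 8) :
    fderiv ℝ (sectionMap ν) w x k = fderiv ℝ (fun w => sectionMap ν w k) w x := by
  have h := (contDiffAt_sectionMap hw).differentiableAt (by simp)
  rw [fderiv_pi fun k => differentiableAt_pi.1 h k]
  rfl

/-- Along the section only `z_ν` and `z_{ν+1}` have imaginary parts that can vary; the other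
coordinates are real, and `planeForm` vanishes on pairs of reals. -/
theorem chartForm_apply {ν : Fin 8} {w : ℂ × ℂ} (hw : w ∈ chartTarget ν) (x y : ℂ × ℂ) :
    chartForm ν w x y = planeForm x.1 y.1 + planeForm x.2 y.2 := by
  have h1 : ∀ x : ℂ × ℂ, fderiv ℝ (sectionMap ν) w x ν = x.1 := fun x => by
    rw [fderiv_sectionMap_apply hw]
    simp only [sectionMap, if_true]
    rw [fderiv_fst]; rfl
  have h2 : ∀ x : ℂ × ℂ, fderiv ℝ (sectionMap ν) w x (ν + 1) = x.2 := fun x => by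
    rw [fderiv_sectionMap_apply hw]
    simp only [sectionMap, add_one_ne, if_true, if_false]
    rw [fderiv_snd]; rfl
  have h3 : ∀ (x : ℂ × ℂ) (k : Fin 8), k ≠ ν ∧ k ≠ ν + 1 →
      (fderiv ℝ (sectionMap ν) w x k).im = 0 := fun x k hk => by
    rw [fderiv_sectionMap_apply hw]
    have hd : DifferentiableAt ℝ (fun w => sectionMap ν w k) w :=
      differentiableAt_pi.1 ((contDiffAt_sectionMap hw).differentiableAt (by simp)) k
    have h := (Complex.imCLM.hasFDerivAt.comp w hd.hasFDerivAt).fderiv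
    have h0 : Complex.imCLM ∘ (fun w => sectionMap ν w k) = fun _ => 0 := by
      funext w
      simp [sectionMap, hk.1, hk.2]
    rw [h0, fderiv_fun_const] at h
    exact (congrArg (fun l : ℂ × ℂ →L[ℝ] ℝ => l x) h).symm
  change ∑ k, planeForm (fderiv ℝ (sectionMap ν) w x k) (fderiv ℝ (sectionMap ν) w y k) = _
  rw [Finset.sum_eq_add ν (ν + 1) (add_one_ne ν).symm
    (fun k _ hk => by simp [planeForm, h3 x k hk, h3 y k hk]) (by simp) (by simp),
    h1, h1, h2, h2]

theorem sectionMap_congr {ν k : Fin 8} {w w' : ℂ × ℂ} (h1 : ‖w.1‖ = ‖w'.1‖) (h2 : ‖w.2‖ = ‖w'.2‖)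
    (hk1 : k = ν → w.1 = w'.1) (hk2 : k = ν + 1 → w.2 = w'.2) :
    sectionMap ν w k = sectionMap ν w' k := by
  unfold sectionMap
  split_ifs with h h'
  · exact hk1 h
  · exact hk2 h'
  · rw [sqModulus_congr ν k h1 h2]

/-- The coordinates of the `ν`-th chart in an order in which the index `i` comes first. -/
theorem exists_coordinate_order {ν i : Fin 8} (hi : i = ν ∨ i = ν + 1) :
    ∃ e : (ℂ × ℂ) ≃L[ℝ] ℂ × ℂ,
      (∀ x y : ℂ × ℂ, planeForm x.1 y.1 + planeForm x.2 y.2 =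
        planeForm (e x).1 (e y).1 + planeForm (e x).2 (e y).2) ∧
      (∀ w, sectionMap ν w i = (e w).1) ∧
      ∀ (k : Fin 8), k ≠ i → ∀ u v : ℂ,
        sectionMap ν (e.symm (-u, v)) k = sectionMap ν (e.symm (u, v)) k := by
  rcases hi with rfl | rfl
  · refine ⟨.refl ℝ _, fun _ _ => rfl, fun w => by simp [sectionMap], fun k hk u v => ?_⟩
    exact sectionMap_congr (by simp) (by simp) (fun h => absurd h hk) (by simp)
  -- Exchanging the two factors preserves the sum of the plane forms.
  · refine ⟨.prodComm ℝ ℂ ℂ, fun _ _ => add_comm _ _, fun w => by simp [sectionMap],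
      fun k hk u v => ?_⟩
    exact sectionMap_congr (by simp) (by simp) (by simp) (fun h => absurd h hk)

/-- `H_t` at the class of a point of the level set. -/
theorem Ht_proj (γ t : ℝ) (z : levelSet) :
    Ht γ t (proj z) = (1 - 2 * t) * (‖z.1 2‖ ^ 2 / 2) + t * γ * (Z z.1).re := rfl

/-- Treats both levels at once: the first manifold equation rewrites `J` as `3 - ‖z 4‖ ^ 2 / 2`, so
each level is an extremum of `J` at which a single coordinate vanishes. -/
theorem exists_J_eq {p : M} (hJ : J p = 0 ∨ J p = 3) :
    ∃ (i : Fin 8) (K c : ℝ), (i = 0 ∨ i = 4) ∧ c ≠ 0 ∧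
      (∀ z : levelSet, J (proj z) = K + c * (‖z.1 i‖ ^ 2 / 2)) ∧
      J p = K := by
  rcases hJ with h | h
  · exact ⟨0, 0, 1, Or.inl rfl, one_ne_zero, fun z => by simp [J, descend_proj], h⟩
  · refine ⟨4, 3, -1, Or.inr rfl, by simp, fun z => ?_, h⟩
    rw [J, descend_proj]
    linarith [z.2.1]

theorem eq_of_mem_chartSource {ν i : Fin 8} {z : levelSet} (hz : proj z ∈ chartSource ν)
    (hi : z.1 i = 0) : i = ν ∨ i = ν + 1 := by
  by_contra h
  rw [not_or] at h
  exact mem_chartSource.1 hz i (mem_others.2 h) hi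

end Octagon

/-! ### Rank-one points on the two extremal levels of `J` -/

open Octagon in
theorem mainTheorem8 (γ t : ℝ) (hγ : γ ≠ 0) (ht : t ∈ Set.Ioc (0 : ℝ) 1) (p : Octagon.M)
    (hp : IsRankOnePoint (E := ℂ × ℂ) (Octagon.Ft γ t) p)
    (hJ : Octagon.J p = 0 ∨ Octagon.J p = 3) :
    IsNondegenerateRankOnePoint (E := ℂ × ℂ) Octagon.symplecticForm (Octagon.Ft γ t) p ∧
      IsEllipticRegularPoint (E := ℂ × ℂ) Octagon.symplecticForm (Octagon.Ft γ t) p := by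
  obtain ⟨i, K, c, hi, hc, hJz, hJp⟩ := exists_J_eq hJ
  set ν := chartIndex p with hν
  set w : ℂ × ℂ := chartAt (ℂ × ℂ) p p with hw
  have hpw : p ∈ chartSource ν := mem_chart_source (ℂ × ℂ) p
  have hwt : w ∈ chartTarget ν := mem_chart_target (ℂ × ℂ) p
  have hwp : chartInv ν w = p := (chartAt (ℂ × ℂ) p).left_inv (mem_chart_source (ℂ × ℂ) p)
  rw [chartInv_eq hwt] at hwp
  -- As `J p = K` and `c ≠ 0`, the coordinate of index `i` vanishes at `p`.
  have hwi : sectionMap ν w i = 0 := by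
    have h := hJz ⟨sectionMap ν w, sectionMap_mem hwt⟩
    rw [hwp, hJp] at h
    simpa [hc] using h
  obtain ⟨e, hpl, hsec, heven⟩ := exists_coordinate_order
    (eq_of_mem_chartSource (hwp ▸ hpw) hwi)
  have hw1 : (e w).1 = 0 := by rw [← hsec, hwi]
  have hnhds : chartTarget ν ∈ nhds w := (isOpen_chartTarget ν).mem_nhds hwt
  have hJev : J ∘ chartInv ν =ᶠ[nhds w]
      fun w => K + c * (‖(ContinuousLinearMap.fst ℝ ℂ ℂ ∘L (e : ℂ × ℂ →L[ℝ] ℂ × ℂ)) w‖ ^ 2 / 2) := by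
    filter_upwards [hnhds] with w' hw'
    rw [Function.comp_apply, chartInv_eq hw', hJz]
    simp only [hsec]
    rfl
  have hHev : Ht γ t ∘ chartInv ν =ᶠ[nhds w] fun w =>
      (1 - 2 * t) * (‖sectionMap ν w 2‖ ^ 2 / 2) + t * γ * (Z (sectionMap ν w)).re := by
    filter_upwards [hnhds] with w' hw'
    rw [Function.comp_apply, chartInv_eq hw', Ht_proj]
  have hdJ : differentialAt (E := ℂ × ℂ) (fun x => (Ft γ t x).1) p = 0 := by
    refine LinearMap.ext fun x => differentialAt_apply_eq_zero (E := ℂ × ℂ) ?_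
    change fderiv ℝ (J ∘ chartInv ν) w x = 0
    rw [hJev.fderiv_eq, fderiv_const_add_mul_sq_norm]
    have h : (ContinuousLinearMap.fst ℝ ℂ ℂ ∘L (e : ℂ × ℂ →L[ℝ] ℂ × ℂ)) w = 0 := hw1
    rw [h, map_zero, ContinuousLinearMap.zero_comp, smul_zero]
    rfl
  have hdH : ∀ u : ℂ, differentialAt (E := ℂ × ℂ) (fun x => (Ft γ t x).2) p (e.symm (u, 0)) = 0 := by
    intro u
    refine differentialAt_apply_eq_zero (E := ℂ × ℂ) ?_
    change fderiv ℝ (Ht γ t ∘ chartInv ν) w _ = 0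
    rw [hHev.fderiv_eq]
    refine fderiv_apply_eq_zero_of_even fun s => ?_
    have hs : ∀ k, k ≠ i → sectionMap ν (w + s • -e.symm (u, 0)) k =
        sectionMap ν (w + s • e.symm (u, 0)) k := fun k hk => by
      -- Since `(e w).1 = 0`, moving from `w` along the first factor by `a` and by `-a` gives points
      -- that differ only in the sign of the first coordinate.
      have h : ∀ a : ℂ, w + e.symm (a, 0) = e.symm (a, (e w).2) := fun a => by
        rw [ContinuousLinearEquiv.eq_symm_apply, map_add, e.apply_symm_apply]
        exact Prod.ext (by simp [hw1]) (by simp)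
      rw [← map_neg, ← map_smul, ← map_smul, Prod.neg_mk, Prod.smul_mk, Prod.smul_mk, neg_zero,
        smul_zero, h, h, smul_neg]
      exact heven k hk _ _
    have hZ : Z (sectionMap ν (w + s • -e.symm (u, 0))) =
        Z (sectionMap ν (w + s • e.symm (u, 0))) := by
      -- `Z` involves all coordinates except those of index `0` and `4`, the two possible values of
      -- `i`.
      unfold Z
      rw [hs 1, hs 2, hs 3, hs 5, hs 6, hs 7] <;> rcases hi with rfl | rfl <;> decide
    have h2 : 2 ≠ i := by rcases hi with rfl | rfl <;> decide
    simp only [hZ, hs 2 h2]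
  have hdH0 : differentialAt (E := ℂ × ℂ) (fun x => (Ft γ t x).2) p ≠ 0 := by
    intro h
    unfold IsRankOnePoint at hp
    rw [hdJ, h] at hp
    have h0 : ((0 : TangentSpace 𝓘(ℝ, ℂ × ℂ) p →ₗ[ℝ] ℝ).prod
        (0 : TangentSpace 𝓘(ℝ, ℂ × ℂ) p →ₗ[ℝ] ℝ)) = 0 := rfl
    rw [h0, LinearMap.range_zero] at hp
    simp at hp
  have hrel : IsDifferentialRelation (E := ℂ × ℂ) (Ft γ t) p 1 0 :=
    ⟨by simp, by rw [hdJ]; simp⟩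
  have : FiniteDimensional ℝ (TangentSpace 𝓘(ℝ, ℂ × ℂ) p) :=
    inferInstanceAs (FiniteDimensional ℝ (ℂ × ℂ))
  have hQ : ∀ x y : ℂ × ℂ, hessianCombination (E := ℂ × ℂ) (Ft γ t) p 1 0 x y =
      c * inner ℝ (e x).1 (e y).1 := by
    intro x y
    have h : hessianCombination (E := ℂ × ℂ) (Ft γ t) p 1 0 x y =
        fderiv ℝ (fderiv ℝ (J ∘ chartInv ν)) w x y := by
      unfold hessianCombination
      rw [one_smul, zero_smul, add_zero]
      rfl
    rw [h, hJev.fderiv.fderiv_eq, fderiv_fderiv_const_add_mul_sq_norm]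
    rfl
  let e' : TangentSpace 𝓘(ℝ, ℂ × ℂ) p ≃ₗ[ℝ] ℂ × ℂ := e.toLinearEquiv
  obtain ⟨hB, hA⟩ := exists_form_and_endomorphism_descend
    e'  (symplecticForm p)
    (fun x y => (chartForm_apply hwt x y).trans (hpl x y)) hdH0 hdH
    (hessianCombination (E := ℂ × ℂ) (Ft γ t) p 1 0) hc hQ
  -- The zero covector in the span is `dJ(p)`, so the span is `orbitLine` at `p`.
  rw [← hdJ] at hB hA
  exact ⟨⟨hp, 1, 0, hrel, hB⟩, ⟨hp, 1, 0, hrel, hB⟩, 1, 0, hrel, hA⟩
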